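/- For a positive integer $q$ and integers $0\le k_1\le k_2$ put $[-k_1,k_2]^*=\{-k_1,-k_1+1,\dots,k_2\}\setminus\{0\}$. A set $B\subseteq\mathbb{Z}_q=\mathbb{Z}/q\mathbb{Z}$ is called a $B[-k_1,k_2](q)$ set (a splitter set) if the sets $\{ab \bmod q : a\in[-k_1,k_2]^*\}$, $b\in B$, each consist of exactly $k_1+k_2$ distinct residues, all nonzero, and are pairwise disjoint. It is called perfect if $(k_1+k_2)\,|B| = q-1$. **Theorem.** Let $k_1,k_2$ be integers with $1\le k_1\le k_2$ and $k_2\ge 3$, and let $n=k_1+k_2+1$. If $n$ is not a prime, then there does not exist a perfect $B[-k_1,k_2](n^2)$ set. -/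

import Mathlib

/-- The set `[-k₁, k₂]^*` of nonzero integers `a` with `-k₁ ≤ a ≤ k₂`. -/
noncomputable def starInterval (k₁ k₂ : ℕ) : Finset ℤ :=
  (Finset.Icc (-(k₁ : ℤ)) (k₂ : ℤ)).erase 0

/-- The set `{a * b mod q : a ∈ [-k₁, k₂]^*}` of residues modulo `q`. -/
noncomputable def starMultiples (k₁ k₂ q : ℕ) (b : ZMod q) : Finset (ZMod q) :=
  (starInterval k₁ k₂).image (fun a : ℤ => (a : ZMod q) * b)

/-- `B` is a `B[-k₁, k₂](q)` set (a splitter set) for the positive integer `q`: each of the sets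
`{a * b mod q : a ∈ [-k₁, k₂]^*}`, `b ∈ B`, consists of `k₁ + k₂` nonzero residues, and these
sets are pairwise disjoint. -/
structure IsSplitterSet (k₁ k₂ q : ℕ) (B : Finset (ZMod q)) : Prop where
  pos : 0 < q
  card_eq : ∀ b ∈ B, (starMultiples k₁ k₂ q b).card = k₁ + k₂
  zero_notMem : ∀ b ∈ B, (0 : ZMod q) ∉ starMultiples k₁ k₂ q b
  disjoint : ∀ b ∈ B, ∀ c ∈ B, b ≠ c →
    Disjoint (starMultiples k₁ k₂ q b) (starMultiples k₁ k₂ q c)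

/-- A `B[-k₁, k₂](q)` set is perfect if its size is exactly `(q - 1) / (k₁ + k₂)`
(the division being exact). -/
def IsPerfectSplitterSet (k₁ k₂ q : ℕ) (B : Finset (ZMod q)) : Prop :=
  IsSplitterSet k₁ k₂ q B ∧ B.card * (k₁ + k₂) = q - 1

/-!
Write `M = [-k₁, k₂]^*`. A perfect splitter set `B` modulo `n ^ 2` factors the nonzero residues as
`M * B`, with `n + 1` elements in `B`. Since `[-k₁, k₂]` is a complete residue system modulo `n`,
counting units shows that `n` elements of `B` are units; the remaining one accounts for the
`n - 1` nonzero multiples of `n`, hence is itself a multiple of `n`. So the units of `B` already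
factor the residues not divisible by `n` (`IsPerfectSplitterSet.exists_isUnitTiling`).

If `n = u * v` with `u > v > 1` coprime, then `u ^ 2` divides `n ^ 2`, is not divisible by `n` and
exceeds every element of `M` in absolute value, so its residue is not covered
(`IsUnitTiling.false_of_coprime_mul`).

There remains `n = p ^ e` with `e ≥ 2`. For each `j < e` the elements of `M` of `p`-adic valuation
`j`, divided by `p ^ j`, form a set `A_j` with `A_j * B` the group of units modulo
`p ^ (2 * e - j)`, each unit being represented once. Hence a nontrivial character of that group sums
to `0` over `A_j` or over `B`. Characters of `p`-power order are given by a discrete logarithm `f`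
(to the base of a primitive root, or of `5` up to sign if `p = 2`), and the vanishing of such a sum
over `S` means that the cyclotomic polynomial `Φ (p ^ i)` divides `∑ X ^ f s`. The set `A_(e-1)` has
`p - 1` elements, so the vanishing on that layer always takes place on `B`
(`IsUnitTiling.cyclotomic_dvd_of_add_le`). For the characters of largest order it takes place on
`B` as well: if the sum vanished on `A_0` (for `p = 2`, on `A_0` or `A_1`), the distribution of the
logarithms on that layer would be invariant under translation by an element of order `p`, and there
are too few small integers whose logarithms are translates of the logarithm of `1`
(`exists_mod_eq_of_cyclotomic_dvd`, `not_cyclotomic_dvd_valuationLayer_odd`,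
`not_cyclotomic_dvd_valuationLayer_two`). Altogether
`e + 1` distinct polynomials `Φ (p ^ i)` divide `∑ X ^ f b`, `b ∈ B`. Each of them is `p` at `1`, so
`p ^ (e + 1)` divides the number `p ^ e` of units in `B`, which is absurd.
-/

/-! ### Vanishing sums of roots of unity of prime power order -/

open Polynomial in
/-- The polynomial `∑ X ^ f s`, `s ∈ S`, recording how the values of `f` are distributed on `S`. -/
noncomputable def exponentSum {ι : Type*} (S : Finset ι) (f : ι → ℕ) : ℤ[X] :=
  ∑ s ∈ S, X ^ f s

open Polynomial in
lemma eval_one_exponentSum {ι : Type*} (S : Finset ι) (f : ι → ℕ) :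
    (exponentSum S f).eval 1 = S.card := by
  simp [exponentSum, eval_finsetSum]

open Polynomial in
lemma cyclotomic_dvd_exponentSum_iff {ι : Type*} (S : Finset ι) (f : ι → ℕ) {n : ℕ} (hn : 0 < n)
    {ζ : ℂ} (hζ : IsPrimitiveRoot ζ n) :
    cyclotomic n ℤ ∣ exponentSum S f ↔ ∑ s ∈ S, ζ ^ f s = 0 := by
  have h : aeval ζ (exponentSum S f) = ∑ s ∈ S, ζ ^ f s := by simp [exponentSum]
  rw [← h, cyclotomic_eq_minpoly hζ hn, minpoly.isIntegrallyClosed_dvd_iff (hζ.isIntegral hn)]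

open Polynomial in
/-- If `Φ (p ^ (i + 1))` divides `∑ X ^ f s`, then the distribution of `f` modulo `p ^ (i + 1)` is
invariant under translation by `p ^ i`; so every translate of an attained value is attained. -/
lemma exists_mod_eq_of_cyclotomic_dvd {ι : Type*} {S : Finset ι} {f : ι → ℕ} {p : ℕ}
    (hp : p.Prime) {i : ℕ} (h : cyclotomic (p ^ (i + 1)) ℤ ∣ exponentSum S f)
    {s₀ : ι} (hs₀ : s₀ ∈ S) {c : ℕ} (hc : c < p) :
    ∃ s ∈ S, f s % p ^ (i + 1) = p ^ i * c + f s₀ % p ^ i := by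
  set q := p ^ i with hq
  have hq0 : 0 < q := pow_pos hp.pos i
  have hpq : p ^ (i + 1) = q * p := pow_succ _ _
  set N := p ^ (i + 1) with hN
  have hN0 : 0 < N := pow_pos hp.pos _
  have hR : cyclotomic N ℤ ∣ exponentSum S (fun s => f s % N) := by
    have h1 : cyclotomic N ℤ ∣ exponentSum S f - exponentSum S (fun s => f s % N) := by
      rw [exponentSum, exponentSum, ← Finset.sum_sub_distrib]
      refine Finset.dvd_sum fun s _ => (cyclotomic.dvd_X_pow_sub_one N ℤ).trans ?_
      have h2 : (X : ℤ[X]) ^ f s - X ^ (f s % N) = X ^ (f s % N) * ((X ^ N) ^ (f s / N) - 1) := by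
        rw [mul_sub, ← pow_mul, ← pow_add, Nat.mod_add_div, mul_one]
      rw [h2]
      refine Dvd.dvd.mul_left ?_ _
      simpa using sub_dvd_pow_sub_pow ((X : ℤ[X]) ^ N) 1 (f s / N)
    exact (dvd_sub_right h).1 h1
  obtain ⟨Q, hQ⟩ := hR
  have hcoeff (k : ℕ) : (exponentSum S (fun s => f s % N)).coeff k
      = (S.filter (fun s => k = f s % N)).card := by
    simp [exponentSum, coeff_X_pow]
  have hne : exponentSum S (fun s => f s % N) ≠ 0 := by
    intro h0
    have := eval_one_exponentSum S (fun s => f s % N)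
    rw [h0, eval_zero] at this
    exact (Finset.card_pos.2 ⟨s₀, hs₀⟩).ne' (by exact_mod_cast this.symm)
  have hQ0 : Q ≠ 0 := by rintro rfl; simp at hQ; exact hne hQ
  have hdeg : Q.natDegree < q := by
    have h1 : (exponentSum S (fun s => f s % N)).natDegree < N := by
      by_contra! hlt
      have h2 := hcoeff (exponentSum S (fun s => f s % N)).natDegree
      rw [Finset.filter_false_of_mem fun s _ => by
        have := Nat.mod_lt (f s) hN0
        omega] at h2
      simp [hne] at h2
    rw [hQ, natDegree_mul (cyclotomic_ne_zero _ _) hQ0, natDegree_cyclotomic, hN,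
      Nat.totient_prime_pow_succ hp, ← hN, ← hq, hpq] at h1
    have h3 : q * p = q * (p - 1) + q := by
      obtain ⟨r, rfl⟩ : ∃ r, p = r + 1 := ⟨p - 1, by have := hp.pos; omega⟩
      simp; ring
    omega
  -- As `Φ = ∑ X ^ (q * c)` and `Q` has degree below `q`, the coefficients of `Φ * Q` are those
  -- of `Q`, repeated `p` times.
  have hblock (d r : ℕ) (hd : d < p) (hr : r < q) :
      (exponentSum S (fun s => f s % N)).coeff (q * d + r) = Q.coeff r := by
    rw [hQ, hN, cyclotomic_prime_pow_eq_geom_sum hp, ← hq, Finset.sum_mul, finsetSum_coeff,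
      Finset.sum_eq_single d]
    · rw [← pow_mul, coeff_X_pow_mul', if_pos (by omega)]
      congr 1; omega
    · intro c _ hcd
      rw [← pow_mul, coeff_X_pow_mul']
      split_ifs with hle
      · refine coeff_eq_zero_of_natDegree_lt (hdeg.trans_le ?_)
        have : c < d := by
          by_contra! hdc
          have : d + 1 ≤ c := by omega
          have := Nat.mul_le_mul_left q this
          rw [mul_add] at this
          omega
        have := Nat.mul_le_mul_left q (show c + 1 ≤ d from this)
        rw [mul_add] at this
        omega
      · rfl
    · intro hd'
      exact absurd (Finset.mem_range.2 hd) hd'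
  have hr : f s₀ % q < q := Nat.mod_lt _ hq0
  have hd₀ : f s₀ % N / q < p := by
    rw [Nat.div_lt_iff_lt_mul hq0, mul_comm, ← hpq]
    exact Nat.mod_lt _ hN0
  have h0 : q * (f s₀ % N / q) + f s₀ % q = f s₀ % N := by
    have h1 : f s₀ % q = f s₀ % N % q := by rw [hpq, Nat.mod_mul_right_mod]
    rw [h1, Nat.div_add_mod]
  have h1 := hblock c _ hc hr
  rw [← hblock _ _ hd₀ hr, h0, hcoeff, hcoeff] at h1
  have h2 : (S.filter (fun s => f s₀ % N = f s % N)).card ≠ 0 :=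
    (Finset.card_pos.2 ⟨s₀, by simp [hs₀]⟩).ne'
  have h3 : (S.filter (fun s => q * c + f s₀ % q = f s % N)).card ≠ 0 := by
    intro h3; rw [h3] at h1; exact h2 (by exact_mod_cast h1.symm)
  obtain ⟨s, hs⟩ := Finset.card_pos.1 (Nat.pos_of_ne_zero h3)
  rw [Finset.mem_filter] at hs
  exact ⟨s, hs.1, hs.2.symm⟩

open Polynomial in
/-- Distinct cyclotomic polynomials of `p`-power order are non-associated irreducible elements
of `ℤ[X]` with value `p` at `1`. -/
lemma prime_pow_card_dvd_card {ι : Type*} {S : Finset ι} {f : ι → ℕ} {p : ℕ} (hp : p.Prime)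
    (I : Finset ℕ) (hI : ∀ i ∈ I, 1 ≤ i ∧ cyclotomic (p ^ i) ℤ ∣ exponentSum S f) :
    p ^ I.card ∣ S.card := by
  have h1 : ∏ i ∈ I, cyclotomic (p ^ i) ℤ ∣ exponentSum S f := by
    refine Finset.prod_dvd_of_isRelPrime (fun i _ j _ hij => ?_) fun i hi => (hI i hi).2
    have hirr (k : ℕ) := cyclotomic.irreducible (pow_pos hp.pos k)
    refine (hirr i).isRelPrime_iff_not_dvd.2 fun hd => hij ?_
    exact Nat.pow_right_injective hp.two_le (cyclotomic_injective
      (eq_of_monic_of_associated (cyclotomic.monic _ _) (cyclotomic.monic _ _)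
        ((hirr i).associated_of_dvd (hirr j) hd)))
  have h2 := eval_dvd (x := 1) h1
  rw [eval_one_exponentSum, eval_prod, Finset.prod_congr rfl (g := fun _ => (p : ℤ)),
    Finset.prod_const] at h2
  · exact_mod_cast h2
  · intro i hi
    obtain ⟨k, rfl⟩ : ∃ k, i = k + 1 := ⟨i - 1, by have := (hI i hi).1; omega⟩
    have := Fact.mk hp
    exact eval_one_cyclotomic_prime_pow k

/-! ### Discrete logarithms modulo prime powers -/

/-- `f` behaves like a discrete logarithm to the prime `p`: up to modulus `p ^ N`, every `p`-power
root of unity `ζ` whose order is at most the modulus divided by `p ^ δ` gives rise to the nontrivial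
Dirichlet character `a ↦ ζ ^ f a`. -/
def IsPrimePowerLog (p δ N : ℕ) (f : ℤ → ℕ) : Prop :=
  ∀ (m i : ℕ) (ζ : ℂ), m ≤ N → 1 ≤ i → i + δ ≤ m → IsPrimitiveRoot ζ (p ^ i) →
    ∃ ψ : DirichletCharacter ℂ (p ^ m), ψ ≠ 1 ∧ ∀ a : ℤ, ¬ (p : ℤ) ∣ a →
      ψ (a : ZMod (p ^ m)) = ζ ^ f a

lemma exists_hom_of_quotient_generator {G : Type*} [CommGroup G] (H : Subgroup G) (g : G)
    (hg : ∀ x : G ⧸ H, x ∈ Subgroup.zpowers (g : G ⧸ H)) {ζ : ℂ} {n : ℕ} (hn : 0 < n)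
    (hζ : IsPrimitiveRoot ζ n) (hord : n ∣ orderOf (g : G ⧸ H)) :
    ∃ φ : G →* ℂˣ, φ g = ζ ∧ ∀ h ∈ H, φ h = 1 := by
  obtain ⟨z, rfl⟩ := hζ.isUnit hn.ne'
  have hz : orderOf z ∣ orderOf (g : G ⧸ H) := by
    rwa [← orderOf_units, ← hζ.eq_orderOf]
  refine ⟨(monoidHomOfForallMemZpowers hg hz).comp (QuotientGroup.mk' H), ?_, ?_⟩
  · simp
  · intro h hh
    have : (QuotientGroup.mk' H) h = 1 := (QuotientGroup.eq_one_iff h).2 hh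
    rw [MonoidHom.comp_apply, this, map_one]

lemma isUnit_intCast_zmod_prime_pow {p : ℕ} (hp : p.Prime) {m : ℕ} {a : ℤ} (ha : ¬ (p : ℤ) ∣ a) :
    IsUnit (a : ZMod (p ^ m)) := by
  rw [ZMod.coe_int_isUnit_iff_isCoprime]
  push_cast
  exact ((Nat.prime_iff_prime_int.1 hp).coprime_iff_not_dvd.2 ha).pow_left

lemma not_dvd_of_isUnit_intCast_zmod_prime_pow {p : ℕ} (hp : p.Prime) {m : ℕ} (hm : 1 ≤ m) {a : ℤ}
    (h : IsUnit (a : ZMod (p ^ m))) : ¬ (p : ℤ) ∣ a := by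
  rw [ZMod.coe_int_isUnit_iff_isCoprime] at h
  push_cast at h
  rw [← (Nat.prime_iff_prime_int.1 hp).coprime_iff_not_dvd]
  exact h.of_isCoprime_of_dvd_left (dvd_pow_self _ (by omega))

lemma intCast_zmod_eq_of_dvd {q : ℕ} {a b : ℤ} {r : ℤ} (hr : (q : ℤ) ∣ r) (h : r ∣ a - b) :
    (a : ZMod q) = b := by
  have := (ZMod.intCast_zmod_eq_zero_iff_dvd (a - b) q).2 (hr.trans h)
  rwa [Int.cast_sub, sub_eq_zero] at this

/-- A discrete logarithm for an odd prime `p`, to the base of a primitive root. -/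
lemma exists_isPrimePowerLog_odd {p : ℕ} (hp : p.Prime) (hp2 : p ≠ 2) {N : ℕ} (hN : 1 ≤ N) :
    ∃ f : ℤ → ℕ, IsPrimePowerLog p 1 N f ∧
      ∀ (a : ℤ) (t : ℕ), ¬ (p : ℤ) ∣ a → t + 1 ≤ N → p ^ t ∣ f a →
        (a : ZMod (p ^ (t + 1))) ^ (p - 1) = 1 := by
  have (m : ℕ) : NeZero (p ^ m) := ⟨(pow_pos hp.pos m).ne'⟩
  have := ZMod.isCyclic_units_of_prime_pow p hp hp2 N
  obtain ⟨γ, hγ⟩ := IsCyclic.exists_generator (α := (ZMod (p ^ N))ˣ)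
  obtain ⟨g, hg⟩ := ZMod.intCast_surjective (γ : ZMod (p ^ N))
  have hpg : ¬ (p : ℤ) ∣ g :=
    not_dvd_of_isUnit_intCast_zmod_prime_pow hp hN (hg ▸ γ.isUnit)
  have hlog (a : ℤ) : ∃ n : ℕ, ¬ (p : ℤ) ∣ a → (p : ℤ) ^ N ∣ a - g ^ n := by
    by_cases ha : (p : ℤ) ∣ a
    · exact ⟨0, fun h => absurd ha h⟩
    obtain ⟨u, hu⟩ := isUnit_intCast_zmod_prime_pow hp (m := N) ha
    obtain ⟨n, hn⟩ := (mem_powers_iff_mem_zpowers.2 (hγ u))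
    refine ⟨n, fun _ => ?_⟩
    have h1 : ((a - g ^ n : ℤ) : ZMod (p ^ N)) = 0 := by
      push_cast
      rw [hg, ← hu, ← hn]; simp
    simpa using (ZMod.intCast_zmod_eq_zero_iff_dvd _ _).1 h1
  choose f hf using hlog
  have hcast (m : ℕ) (hm : m ≤ N) (a : ℤ) (ha : ¬ (p : ℤ) ∣ a) :
      (a : ZMod (p ^ m)) = (g : ZMod (p ^ m)) ^ f a := by
    have := intCast_zmod_eq_of_dvd (q := p ^ m) (r := (p : ℤ) ^ N)
      (by push_cast; exact pow_dvd_pow _ hm) (hf a ha)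
    simpa using this
  refine ⟨f, ?_, ?_⟩
  · intro m i ζ hm hi him hζ
    obtain ⟨u, hu⟩ := isUnit_intCast_zmod_prime_pow hp (m := m) hpg
    have hgen : ∀ x : (ZMod (p ^ m))ˣ ⧸ (⊥ : Subgroup (ZMod (p ^ m))ˣ),
        x ∈ Subgroup.zpowers (u : (ZMod (p ^ m))ˣ ⧸ (⊥ : Subgroup (ZMod (p ^ m))ˣ)) := by
      intro x
      obtain ⟨x, rfl⟩ := QuotientGroup.mk_surjective x
      obtain ⟨a, ha⟩ := ZMod.intCast_surjective (x : ZMod (p ^ m))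
      have hpa := not_dvd_of_isUnit_intCast_zmod_prime_pow hp (by omega) (ha ▸ x.isUnit)
      have : x = u ^ f a := by
        ext
        rw [← ha, hcast m hm a hpa, Units.val_pow_eq_pow_val, hu]
      rw [this]
      exact ⟨f a, by simp⟩
    have hord : p ^ i ∣ orderOf (u : (ZMod (p ^ m))ˣ ⧸ (⊥ : Subgroup (ZMod (p ^ m))ˣ)) := by
      rw [orderOf_eq_card_of_forall_mem_zpowers hgen]
      have h1 := Subgroup.card_eq_card_quotient_mul_card_subgroup (⊥ : Subgroup (ZMod (p ^ m))ˣ)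
      rw [Subgroup.card_bot, mul_one] at h1
      rw [← h1, Nat.card_eq_fintype_card, ZMod.card_units_eq_totient,
        Nat.totient_prime_pow hp (by omega)]
      exact Dvd.dvd.mul_right (pow_dvd_pow _ (by omega)) _
    obtain ⟨φ, hφ, -⟩ := exists_hom_of_quotient_generator _ u hgen (pow_pos hp.pos i) hζ hord
    have hval : MulChar.ofUnitHom φ (g : ZMod (p ^ m)) = ζ := by
      rw [← hu, MulChar.ofUnitHom_coe, hφ]
    refine ⟨MulChar.ofUnitHom φ, ?_, ?_⟩
    · intro h1
      rw [h1, ← hu, MulChar.one_apply_coe] at hval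
      exact hζ.ne_one (Nat.one_lt_pow (by omega) hp.one_lt) hval.symm
    · intro a ha
      rw [hcast m hm a ha, map_pow, hval]
  · intro a t ha ht htf
    rw [hcast (t + 1) ht a ha, ← pow_mul]
    obtain ⟨u, hu⟩ := isUnit_intCast_zmod_prime_pow hp (m := t + 1) hpg
    have h1 : u ^ (f a * (p - 1)) = 1 := by
      apply orderOf_dvd_iff_pow_eq_one.1
      refine (orderOf_dvd_card).trans ?_
      rw [ZMod.card_units_eq_totient, Nat.totient_prime_pow_succ hp]
      exact Nat.mul_dvd_mul_right htf _
    rw [← hu, ← Units.val_pow_eq_pow_val, h1, Units.val_one]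

/-- The classes of `5` and of `-1` generate the units modulo `2 ^ m`, and `5` has the order
`2 ^ (m - 2)` modulo `-1`. -/
lemma zmod_two_pow_quotient_neg_one {m : ℕ} (hm : 2 ≤ m) (u : (ZMod (2 ^ m))ˣ)
    (hu : (u : ZMod (2 ^ m)) = 5) :
    orderOf (u : (ZMod (2 ^ m))ˣ ⧸ Subgroup.zpowers (-1 : (ZMod (2 ^ m))ˣ)) = 2 ^ (m - 2) ∧
    ∀ x, x ∈ Subgroup.zpowers
      (u : (ZMod (2 ^ m))ˣ ⧸ Subgroup.zpowers (-1 : (ZMod (2 ^ m))ˣ)) := by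
  have : NeZero (2 ^ m) := ⟨(pow_pos two_pos m).ne'⟩
  have h4 : (4 : ℕ) ∣ 2 ^ m := pow_dvd_pow 2 hm
  set π := ZMod.castHom h4 (ZMod 4) with hπ
  have hord : orderOf u = 2 ^ (m - 2) := by
    rw [← orderOf_units, hu]
    obtain ⟨k, rfl⟩ : ∃ k, m = k + 2 := ⟨m - 2, by omega⟩
    simpa using ZMod.orderOf_five k
  have hne : (-1 : (ZMod (2 ^ m))ˣ) ≠ 1 := by
    intro h
    have h1 := congrArg π (congrArg Units.val h)
    rw [Units.val_neg, Units.val_one, map_neg, map_one] at h1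
    exact absurd h1 (by decide)
  have hcard1 : Nat.card (Subgroup.zpowers (-1 : (ZMod (2 ^ m))ˣ)) = 2 := by
    rw [Nat.card_zpowers]
    exact orderOf_eq_prime (by simp) hne
  have hcard : Nat.card ((ZMod (2 ^ m))ˣ ⧸ Subgroup.zpowers (-1 : (ZMod (2 ^ m))ˣ))
      = 2 ^ (m - 2) := by
    have h1 := Subgroup.card_eq_card_quotient_mul_card_subgroup
      (Subgroup.zpowers (-1 : (ZMod (2 ^ m))ˣ))
    rw [hcard1, Nat.card_eq_fintype_card, ZMod.card_units_eq_totient,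
      Nat.totient_prime_pow Nat.prime_two (by omega)] at h1
    have h2 : 2 ^ (m - 1) = 2 ^ (m - 2) * 2 := by rw [← pow_succ]; congr 1; omega
    omega
  have hordq : orderOf (u : (ZMod (2 ^ m))ˣ ⧸ Subgroup.zpowers (-1 : (ZMod (2 ^ m))ˣ))
      = 2 ^ (m - 2) := by
    apply Nat.dvd_antisymm
    · rw [← hcard]; exact orderOf_dvd_natCard _
    · rw [← hord, orderOf_dvd_iff_pow_eq_one]
      set k := orderOf (u : (ZMod (2 ^ m))ˣ ⧸ Subgroup.zpowers (-1 : (ZMod (2 ^ m))ˣ))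
      have h1 : ((u ^ k : (ZMod (2 ^ m))ˣ) : (ZMod (2 ^ m))ˣ ⧸ Subgroup.zpowers (-1)) = 1 := by
        rw [QuotientGroup.mk_pow, pow_orderOf_eq_one]
      rw [QuotientGroup.eq_one_iff] at h1
      obtain ⟨z, hz⟩ := h1
      rcases Int.even_or_odd z with he | ho
      · rw [← hz]; exact he.neg_one_zpow
      · -- `5 ^ k = -1` is impossible modulo `4`
        have hz' : u ^ k = -1 := by rw [← hz]; exact ho.neg_one_zpow
        have h2 := congrArg π (congrArg Units.val hz')
        rw [Units.val_pow_eq_pow_val, hu, Units.val_neg, Units.val_one, map_pow, map_neg,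
          map_one, map_ofNat, show (5 : ZMod 4) = 1 from by decide, one_pow] at h2
        exact absurd h2 (by decide)
  refine ⟨hordq, fun x => ?_⟩
  have h1 : Subgroup.zpowers
      (u : (ZMod (2 ^ m))ˣ ⧸ Subgroup.zpowers (-1 : (ZMod (2 ^ m))ˣ)) = ⊤ := by
    apply Subgroup.eq_top_of_card_eq
    rw [Nat.card_zpowers, hordq, hcard]
  rw [h1]; trivial

/-- A discrete logarithm for the prime `2`: odd integers are written as `± 5 ^ f a`. -/
lemma exists_isPrimePowerLog_two {N : ℕ} (hN : 2 ≤ N) :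
    ∃ f : ℤ → ℕ, IsPrimePowerLog 2 2 N f ∧ 2 ^ (N - 2) ∣ f (-1) ∧
      ∀ (a : ℤ) (t : ℕ), ¬ (2 : ℤ) ∣ a → t + 2 ≤ N → 2 ^ t ∣ f a →
        2 ^ (t + 2) ∣ a - 1 ∨ 2 ^ (t + 2) ∣ a + 1 := by
  have (m : ℕ) : NeZero (2 ^ m) := ⟨(pow_pos two_pos m).ne'⟩
  have h5 : ¬ ((2 : ℕ) : ℤ) ∣ 5 := by norm_num
  have hlog (a : ℤ) : ∃ n : ℕ, ¬ (2 : ℤ) ∣ a →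
      ((2 : ℤ) ^ N ∣ a - 5 ^ n ∨ (2 : ℤ) ^ N ∣ a - (-1) * 5 ^ n) := by
    by_cases ha : (2 : ℤ) ∣ a
    · exact ⟨0, fun h => absurd ha h⟩
    obtain ⟨u, hu⟩ := isUnit_intCast_zmod_prime_pow Nat.prime_two (m := N) h5
    obtain ⟨v, hv⟩ := isUnit_intCast_zmod_prime_pow Nat.prime_two (m := N)
      (show ¬ ((2 : ℕ) : ℤ) ∣ a by simpa using ha)
    have hgen := (zmod_two_pow_quotient_neg_one hN u (by simpa using hu)).2 v
    obtain ⟨n, hn⟩ := mem_powers_iff_mem_zpowers.2 hgen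
    refine ⟨n, fun _ => ?_⟩
    have h1 : ((u ^ n : (ZMod (2 ^ N))ˣ) : (ZMod (2 ^ N))ˣ ⧸ Subgroup.zpowers (-1)) = v := by
      rw [QuotientGroup.mk_pow]; exact hn
    rw [QuotientGroup.eq] at h1
    obtain ⟨z, hz⟩ := h1
    have hz' : v = u ^ n * (-1) ^ z := by
      rw [show (-1 : (ZMod (2 ^ N))ˣ) ^ z = (u ^ n)⁻¹ * v from hz]; simp
    rcases Int.even_or_odd z with he | ho
    · left
      rw [he.neg_one_zpow, mul_one] at hz'
      have h2 : ((a - 5 ^ n : ℤ) : ZMod (2 ^ N)) = 0 := by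
        have := congrArg Units.val hz'
        rw [Units.val_pow_eq_pow_val, hu, hv] at this
        push_cast at this ⊢
        rw [this, sub_self]
      simpa using (ZMod.intCast_zmod_eq_zero_iff_dvd _ _).1 h2
    · right
      rw [ho.neg_one_zpow] at hz'
      have h2 : ((a - (-1) * 5 ^ n : ℤ) : ZMod (2 ^ N)) = 0 := by
        have := congrArg Units.val hz'
        rw [Units.val_mul, Units.val_neg, Units.val_one, Units.val_pow_eq_pow_val, hu, hv] at this
        push_cast at this ⊢
        rw [this]; ring
      simpa using (ZMod.intCast_zmod_eq_zero_iff_dvd _ _).1 h2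
  choose f hf using hlog
  have hcast (m : ℕ) (hm : m ≤ N) (a : ℤ) (ha : ¬ (2 : ℤ) ∣ a) :
      (a : ZMod (2 ^ m)) = 5 ^ f a ∨ (a : ZMod (2 ^ m)) = (-1) * 5 ^ f a := by
    have hd : ((2 ^ m : ℕ) : ℤ) ∣ (2 : ℤ) ^ N := by push_cast; exact pow_dvd_pow _ hm
    refine (hf a ha).imp (fun h => ?_) (fun h => ?_)
    · simpa using intCast_zmod_eq_of_dvd hd h
    · simpa using intCast_zmod_eq_of_dvd hd h
  -- modulo `-1`, an odd integer `a` is the power `5 ^ f a`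
  have hquot (m : ℕ) (hm : m ≤ N) (a : ℤ) (ha : ¬ (2 : ℤ) ∣ a) (u v : (ZMod (2 ^ m))ˣ)
      (hu : (u : ZMod (2 ^ m)) = 5) (hv : (v : ZMod (2 ^ m)) = a) :
      (v : (ZMod (2 ^ m))ˣ ⧸ Subgroup.zpowers (-1 : (ZMod (2 ^ m))ˣ)) = u ^ f a := by
    rw [← QuotientGroup.mk_pow, QuotientGroup.eq]
    rcases hcast m hm a ha with h | h
    · have : v = u ^ f a := by ext; rw [hv, h, Units.val_pow_eq_pow_val, hu]
      rw [this, inv_mul_cancel]; exact one_mem _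
    · have : v = u ^ f a * -1 := by
        ext
        rw [hv, h, Units.val_mul, Units.val_pow_eq_pow_val, hu, Units.val_neg, Units.val_one,
          mul_comm]
      rw [this, mul_inv_rev, inv_mul_cancel_right]
      exact inv_mem (Subgroup.mem_zpowers _)
  refine ⟨f, ?_, ?_, ?_⟩
  · intro m i ζ hm hi him hζ
    obtain ⟨u, hu⟩ := isUnit_intCast_zmod_prime_pow Nat.prime_two (m := m) h5
    replace hu : (u : ZMod (2 ^ m)) = 5 := by simpa using hu
    obtain ⟨hord, hgen⟩ := zmod_two_pow_quotient_neg_one (by omega) u hu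
    obtain ⟨φ, hφ, hφ1⟩ := exists_hom_of_quotient_generator _ u hgen (pow_pos two_pos i) hζ
      (by rw [hord]; exact pow_dvd_pow _ (by omega))
    have hval : MulChar.ofUnitHom φ (5 : ZMod (2 ^ m)) = ζ := by
      rw [← hu, MulChar.ofUnitHom_coe, hφ]
    have hneg : MulChar.ofUnitHom φ (-1 : ZMod (2 ^ m)) = 1 := by
      have := MulChar.ofUnitHom_coe φ (-1)
      rw [hφ1 _ (Subgroup.mem_zpowers _)] at this
      simpa using this
    refine ⟨MulChar.ofUnitHom φ, ?_, ?_⟩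
    · intro h1
      rw [h1, ← hu, MulChar.one_apply_coe] at hval
      exact hζ.ne_one (Nat.one_lt_pow (by omega) one_lt_two) hval.symm
    · intro a ha
      rcases hcast m hm a (by simpa using ha) with h | h
      · rw [h, map_pow, hval]
      · rw [h, map_mul, hneg, one_mul, map_pow, hval]
  · obtain ⟨u, hu⟩ := isUnit_intCast_zmod_prime_pow Nat.prime_two (m := N) h5
    replace hu : (u : ZMod (2 ^ N)) = 5 := by simpa using hu
    rw [← (zmod_two_pow_quotient_neg_one hN u hu).1, orderOf_dvd_iff_pow_eq_one,
      ← hquot N le_rfl (-1) (by norm_num) u (-1) hu (by simp), QuotientGroup.eq_one_iff]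
    exact Subgroup.mem_zpowers _
  · intro a t ha ht htf
    obtain ⟨u, hu⟩ := isUnit_intCast_zmod_prime_pow Nat.prime_two (m := t + 2) h5
    replace hu : (u : ZMod (2 ^ (t + 2))) = 5 := by simpa using hu
    obtain ⟨v, hv⟩ := isUnit_intCast_zmod_prime_pow Nat.prime_two (m := t + 2)
      (show ¬ ((2 : ℕ) : ℤ) ∣ a by simpa using ha)
    have h1 := hquot (t + 2) ht a ha u v hu hv
    have h2 : (u : (ZMod (2 ^ (t + 2)))ˣ ⧸ Subgroup.zpowers (-1 : (ZMod (2 ^ (t + 2)))ˣ)) ^ f a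
        = 1 := by
      rw [← orderOf_dvd_iff_pow_eq_one, (zmod_two_pow_quotient_neg_one (by omega) u hu).1]
      simpa using htf
    rw [h2, QuotientGroup.eq_one_iff] at h1
    obtain ⟨z, hz⟩ := h1
    rcases Int.even_or_odd z with he | ho
    · left
      have h3 : v = 1 := by rw [← hz]; exact he.neg_one_zpow
      rw [h3, Units.val_one] at hv
      have h4 : ((a - 1 : ℤ) : ZMod (2 ^ (t + 2))) = 0 := by push_cast; rw [← hv, sub_self]
      simpa using (ZMod.intCast_zmod_eq_zero_iff_dvd _ _).1 h4
    · right
      have h3 : v = -1 := by rw [← hz]; exact ho.neg_one_zpow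
      rw [h3, Units.val_neg, Units.val_one] at hv
      have h4 : ((a + 1 : ℤ) : ZMod (2 ^ (t + 2))) = 0 := by
        push_cast; rw [← hv, neg_add_cancel]
      simpa using (ZMod.intCast_zmod_eq_zero_iff_dvd _ _).1 h4

/-! ### Reduction to the units of a perfect splitter set -/

lemma mem_starInterval {k₁ k₂ : ℕ} {a : ℤ} :
    a ∈ starInterval k₁ k₂ ↔ a ≠ 0 ∧ -(k₁ : ℤ) ≤ a ∧ a ≤ k₂ := by
  simp [starInterval]

lemma card_starInterval (k₁ k₂ : ℕ) : (starInterval k₁ k₂).card = k₁ + k₂ := by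
  rw [starInterval, Finset.card_erase_of_mem (by simp), Int.card_Icc]
  omega

lemma eq_of_dvd_sub_of_mem_starInterval {k₁ k₂ n : ℕ} (hn : n = k₁ + k₂ + 1) {a a' : ℤ}
    (ha : a ∈ starInterval k₁ k₂) (ha' : a' ∈ starInterval k₁ k₂) (h : (n : ℤ) ∣ a - a') :
    a = a' := by
  rw [mem_starInterval] at ha ha'
  have := Int.eq_zero_of_abs_lt_dvd h (by rw [abs_lt]; omega)
  omega

lemma not_dvd_of_mem_starInterval {k₁ k₂ n : ℕ} (hn : n = k₁ + k₂ + 1) {a : ℤ}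
    (ha : a ∈ starInterval k₁ k₂) : ¬ (n : ℤ) ∣ a := by
  intro h
  rw [mem_starInterval] at ha
  exact ha.1 (Int.eq_zero_of_abs_lt_dvd h (by rw [abs_lt]; omega))

/-- A set `B` of `n` integers coprime to `n` such that the integers not divisible by `n` are,
modulo `n ^ 2`, uniquely the products of an element of `[-k₁, k₂]^*` and an element of `B`. -/
structure IsUnitTiling (k₁ k₂ n : ℕ) (B : Finset ℤ) : Prop where
  card_eq : B.card = n
  isCoprime : ∀ b ∈ B, IsCoprime b (n : ℤ)
  exists_mul : ∀ x : ℤ, ¬ (n : ℤ) ∣ x →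
    ∃ a ∈ starInterval k₁ k₂, ∃ b ∈ B, (n : ℤ) ^ 2 ∣ x - a * b
  eq_of_dvd : ∀ a ∈ starInterval k₁ k₂, ∀ a' ∈ starInterval k₁ k₂, ∀ b ∈ B, ∀ b' ∈ B,
    (n : ℤ) ^ 2 ∣ a * b - a' * b' → a = a' ∧ b = b'

lemma mulChar_one_apply_eq_ite {R : Type*} [CommRing R] (a : R) [Decidable (IsUnit a)] :
    (1 : MulChar R ℤ) a = if IsUnit a then 1 else 0 := by
  split_ifs with h
  · exact MulChar.one_apply h
  · exact MulChar.map_nonunit _ h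

lemma mulChar_one_intCast_sq (n : ℕ) (a : ℤ) :
    (1 : MulChar (ZMod (n ^ 2)) ℤ) (a : ZMod (n ^ 2)) = (1 : MulChar (ZMod n) ℤ) (a : ZMod n) := by
  have h : IsUnit (a : ZMod (n ^ 2)) ↔ IsUnit (a : ZMod n) := by
    rw [ZMod.coe_int_isUnit_iff_isCoprime, ZMod.coe_int_isUnit_iff_isCoprime]
    push_cast
    exact IsCoprime.pow_left_iff two_pos
  by_cases hu : IsUnit (a : ZMod n)
  · rw [MulChar.one_apply hu, MulChar.one_apply (h.2 hu)]
  · rw [MulChar.map_nonunit _ hu, MulChar.map_nonunit _ fun hu' => hu (h.1 hu')]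

/-- The interval `[-k₁, k₂]` being a complete residue system modulo `n`, it contains `φ n` integers
coprime to `n`. -/
lemma sum_starInterval_mulChar_one {k₁ k₂ n : ℕ} (hn : n = k₁ + k₂ + 1) (hn1 : 1 < n) :
    ∑ a ∈ starInterval k₁ k₂, (1 : MulChar (ZMod n) ℤ) (a : ZMod n) = n.totient := by
  have : NeZero n := ⟨by omega⟩
  have : Fact (1 < n) := ⟨hn1⟩
  rw [← ZMod.card_units_eq_totient, ← MulChar.sum_one_eq_card_units]
  refine Finset.sum_of_injOn (fun a : ℤ => (a : ZMod n)) ?_ (fun _ _ => Finset.mem_coe.2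
    (Finset.mem_univ _)) ?_ (fun _ _ => rfl)
  · intro a ha a' ha' h
    refine eq_of_dvd_sub_of_mem_starInterval hn ha ha' ?_
    rw [← ZMod.intCast_zmod_eq_zero_iff_dvd]
    push_cast
    rw [sub_eq_zero]; exact h
  · intro x _ hx
    have hx0 : x = 0 := by
      by_contra h0
      apply hx
      have hv : x.val ≠ 0 := by rwa [Ne, ZMod.val_eq_zero]
      have hlt := ZMod.val_lt x
      by_cases hle : x.val ≤ k₂
      · exact ⟨x.val, Finset.mem_coe.2 (mem_starInterval.2 (by omega)), by simp⟩
      · exact ⟨x.val - n, Finset.mem_coe.2 (mem_starInterval.2 (by omega)), by simp⟩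
    rw [hx0]
    exact MulChar.map_nonunit _ not_isUnit_zero

section Perfect

variable {k₁ k₂ q : ℕ} {B : Finset (ZMod q)}

lemma IsSplitterSet.eq_of_mul_eq (h : IsSplitterSet k₁ k₂ q B) {a a' : ℤ} {b b' : ZMod q}
    (ha : a ∈ starInterval k₁ k₂) (ha' : a' ∈ starInterval k₁ k₂) (hb : b ∈ B) (hb' : b' ∈ B)
    (hab : (a : ZMod q) * b = a' * b') : a = a' ∧ b = b' := by
  have hbb : b = b' := by
    by_contra hne
    refine Finset.disjoint_left.1 (h.disjoint b hb b' hb' hne)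
      (Finset.mem_image_of_mem _ ha) ?_
    simp only [hab]
    exact Finset.mem_image_of_mem (fun a : ℤ => (a : ZMod q) * b') ha'
  subst hbb
  refine ⟨?_, rfl⟩
  have hinj : Set.InjOn (fun a : ℤ => (a : ZMod q) * b) (starInterval k₁ k₂) := by
    rw [← Finset.card_image_iff, card_starInterval]
    exact h.card_eq b hb
  exact hinj ha ha' hab

lemma IsPerfectSplitterSet.exists_mul_eq (h : IsPerfectSplitterSet k₁ k₂ q B) {x : ZMod q}
    (hx : x ≠ 0) : ∃ a ∈ starInterval k₁ k₂, ∃ b ∈ B, (a : ZMod q) * b = x := by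
  have : NeZero q := ⟨h.1.pos.ne'⟩
  have hcard : (B.biUnion (starMultiples k₁ k₂ q)).card = q - 1 := by
    rw [Finset.card_biUnion (fun b hb c hc hbc => h.1.disjoint b hb c hc hbc),
      Finset.sum_congr rfl h.1.card_eq, Finset.sum_const, smul_eq_mul, h.2]
  have hsub : B.biUnion (starMultiples k₁ k₂ q) ⊆ Finset.univ.erase 0 := by
    intro y hy
    obtain ⟨b, hb, hy⟩ := Finset.mem_biUnion.1 hy
    refine Finset.mem_erase.2 ⟨?_, Finset.mem_univ _⟩
    rintro rfl
    exact h.1.zero_notMem b hb hy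
  have heq := Finset.eq_of_subset_of_card_le hsub
    (by rw [hcard, Finset.card_erase_of_mem (Finset.mem_univ _), Finset.card_univ, ZMod.card])
  have hx' : x ∈ B.biUnion (starMultiples k₁ k₂ q) := by rw [heq]; simp [hx]
  obtain ⟨b, hb, hx'⟩ := Finset.mem_biUnion.1 hx'
  obtain ⟨a, ha, hab⟩ := Finset.mem_image.1 hx'
  exact ⟨a, ha, b, hb, hab⟩

end Perfect

/-- A perfect splitter set modulo `n ^ 2` consists of `n` units and of one multiple of `n`: counting
units gives the number `n` of units, and the single nonunit has to produce the `n - 1` nonzero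
multiples of `n`. -/
lemma IsPerfectSplitterSet.exists_isUnitTiling {k₁ k₂ n : ℕ} (hk₁ : 1 ≤ k₁) (hk : k₁ ≤ k₂)
    (hn : n = k₁ + k₂ + 1) {B : Finset (ZMod (n ^ 2))} (h : IsPerfectSplitterSet k₁ k₂ (n ^ 2) B) :
    ∃ B' : Finset ℤ, IsUnitTiling k₁ k₂ n B' := by
  classical
  have hn0 : 0 < n := by omega
  have hq1 : 1 < n ^ 2 := Nat.one_lt_pow two_ne_zero (by omega)
  have : NeZero (n ^ 2) := ⟨by omega⟩
  have : Fact (1 < n ^ 2) := ⟨hq1⟩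
  have hM1 : (1 : ℤ) ∈ starInterval k₁ k₂ := mem_starInterval.2 (by omega)
  have hsum : (∑ a ∈ starInterval k₁ k₂, (1 : MulChar (ZMod (n ^ 2)) ℤ) (a : ZMod (n ^ 2)))
      * ∑ b ∈ B, (1 : MulChar (ZMod (n ^ 2)) ℤ) b = (n ^ 2).totient := by
    rw [← ZMod.card_units_eq_totient, ← MulChar.sum_one_eq_card_units, Finset.sum_mul_sum,
      ← Finset.sum_product']
    refine Finset.sum_of_injOn (fun ab : ℤ × ZMod (n ^ 2) => (ab.1 : ZMod (n ^ 2)) * ab.2) ?_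
      (fun _ _ => Finset.mem_coe.2 (Finset.mem_univ _)) ?_ (fun _ _ => (map_mul _ _ _).symm)
    · rintro ⟨a, b⟩ hab ⟨a', b'⟩ hab' heq
      rw [Finset.mem_coe, Finset.mem_product] at hab hab'
      obtain ⟨h1, h2⟩ := h.1.eq_of_mul_eq hab.1 hab'.1 hab.2 hab'.2 heq
      exact Prod.ext h1 h2
    · intro x _ hx
      have hx0 : x = 0 := by
        by_contra h0
        obtain ⟨a, ha, b, hb, hab⟩ := h.exists_mul_eq h0
        exact hx ⟨(a, b), Finset.mem_coe.2 (Finset.mem_product.2 ⟨ha, hb⟩), hab⟩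
      rw [hx0]
      exact MulChar.map_nonunit _ not_isUnit_zero
  have hU : (B.filter IsUnit).card = n := by
    have h1 : ∑ b ∈ B, (1 : MulChar (ZMod (n ^ 2)) ℤ) b = (B.filter IsUnit).card := by
      rw [Finset.sum_congr rfl fun b _ => mulChar_one_apply_eq_ite b, Finset.sum_boole]
    rw [h1, Finset.sum_congr rfl fun a _ => mulChar_one_intCast_sq n a,
      sum_starInterval_mulChar_one hn (by omega)] at hsum
    have h2 := Nat.totient_gcd_mul_totient_mul n n
    rw [Nat.gcd_self, ← sq, mul_assoc] at h2
    have hφ := Nat.totient_pos.2 hn0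
    have h3 := Nat.eq_of_mul_eq_mul_left hφ h2
    rw [h3] at hsum
    exact Nat.eq_of_mul_eq_mul_left hφ (by exact_mod_cast hsum)
  have hB : B.card = n + 1 := by
    have h1 := h.2
    have h2 : k₁ + k₂ = n - 1 := by omega
    obtain ⟨r, rfl⟩ : ∃ r, n = r + 1 := ⟨n - 1, by omega⟩
    rw [h2] at h1
    have h3 : (r + 1) ^ 2 - 1 = (r + 1 + 1) * r := by
      have : (r + 1) ^ 2 = (r + 1 + 1) * r + 1 := by ring
      omega
    rw [h3] at h1
    exact Nat.eq_of_mul_eq_mul_right (by omega) h1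
  obtain ⟨b₀, hb₀⟩ : ∃ b₀, B.filter (fun b => ¬ IsUnit b) = {b₀} := by
    rw [← Finset.card_eq_one]
    have := Finset.card_filter_add_card_filter_not (s := B) IsUnit
    omega
  have hmem₀ {b : ZMod (n ^ 2)} (hb : b ∈ B) (hbu : ¬ IsUnit b) : b = b₀ := by
    have : b ∈ B.filter (fun b => ¬ IsUnit b) := Finset.mem_filter.2 ⟨hb, hbu⟩
    rw [hb₀] at this
    exact Finset.mem_singleton.1 this
  have hb₀B : b₀ ∈ B := by
    have : b₀ ∈ B.filter (fun b => ¬ IsUnit b) := by rw [hb₀]; simp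
    exact (Finset.mem_filter.1 this).1
  set π := ZMod.castHom (dvd_pow_self n two_ne_zero) (ZMod n) with hπ
  have hπb₀ : π b₀ = 0 := by
    set Z := (Finset.Ico 1 n).image (fun i : ℕ => ((n * i : ℕ) : ZMod (n ^ 2))) with hZ
    have hlt {i : ℕ} (hi : i < n) : n * i < n ^ 2 := by
      rw [sq]; exact Nat.mul_lt_mul_of_pos_left hi hn0
    have hZcard : Z.card = n - 1 := by
      rw [hZ, Finset.card_image_of_injOn, Nat.card_Ico]
      intro i hi j hj hij
      rw [Finset.mem_coe, Finset.mem_Ico] at hi hj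
      have h1 := (ZMod.natCast_eq_natCast_iff' _ _ _).1 hij
      rw [Nat.mod_eq_of_lt (hlt hi.2), Nat.mod_eq_of_lt (hlt hj.2)] at h1
      exact Nat.eq_of_mul_eq_mul_left hn0 h1
    have hZsub : Z ⊆ starMultiples k₁ k₂ (n ^ 2) b₀ := by
      intro z hz
      obtain ⟨i, hi, rfl⟩ := Finset.mem_image.1 hz
      rw [Finset.mem_Ico] at hi
      have hz0 : ((n * i : ℕ) : ZMod (n ^ 2)) ≠ 0 := by
        rw [Ne, ZMod.natCast_eq_zero_iff]
        exact Nat.not_dvd_of_pos_of_lt (Nat.mul_pos hn0 hi.1) (hlt hi.2)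
      obtain ⟨a, ha, b, hb, hab⟩ := h.exists_mul_eq hz0
      by_cases hbu : IsUnit b
      · exfalso
        have h1 := congrArg π hab
        rw [map_mul, map_intCast, map_natCast, Nat.cast_mul, ZMod.natCast_self, zero_mul,
          (hbu.map π).mul_left_eq_zero, ZMod.intCast_zmod_eq_zero_iff_dvd] at h1
        exact not_dvd_of_mem_starInterval hn ha h1
      · rw [← hab, hmem₀ hb hbu]
        exact Finset.mem_image_of_mem (fun a : ℤ => (a : ZMod (n ^ 2)) * b₀) ha
    have heq := Finset.eq_of_subset_of_card_le hZsub
      (by rw [hZcard, h.1.card_eq b₀ hb₀B]; omega)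
    have : b₀ ∈ Z := by
      rw [heq]
      exact Finset.mem_image.2 ⟨1, hM1, by simp⟩
    obtain ⟨i, -, hi⟩ := Finset.mem_image.1 this
    rw [← hi, map_natCast, Nat.cast_mul, ZMod.natCast_self, zero_mul]
  have hcast (b : ZMod (n ^ 2)) : (((b.val : ℕ) : ℤ) : ZMod (n ^ 2)) = b := by simp
  have hdvd (x y : ℤ) : (n : ℤ) ^ 2 ∣ x - y ↔ (x : ZMod (n ^ 2)) = y := by
    rw [← sub_eq_zero, ← Int.cast_sub, ZMod.intCast_zmod_eq_zero_iff_dvd]; push_cast; rfl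
  refine ⟨(B.filter IsUnit).image (fun b => (b.val : ℤ)), ?_, ?_, ?_, ?_⟩
  · rw [Finset.card_image_of_injective, hU]
    intro x y hxy
    exact ZMod.val_injective _ (Nat.cast_injective (R := ℤ) hxy)
  · simp only [Finset.mem_image, Finset.mem_filter]
    rintro _ ⟨b, ⟨_, hbu⟩, rfl⟩
    rw [← hcast b, ZMod.coe_int_isUnit_iff_isCoprime] at hbu
    push_cast at hbu
    exact ((IsCoprime.pow_left_iff two_pos).1 hbu).symm
  · intro x hx
    have hx0 : (x : ZMod (n ^ 2)) ≠ 0 := by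
      intro h0
      rw [ZMod.intCast_zmod_eq_zero_iff_dvd] at h0
      push_cast at h0
      exact hx ((dvd_pow_self _ two_ne_zero).trans h0)
    obtain ⟨a, ha, b, hb, hab⟩ := h.exists_mul_eq hx0
    have hbu : IsUnit b := by
      by_contra hbu
      have h1 := congrArg π hab
      rw [map_mul, hmem₀ hb hbu, hπb₀, mul_zero, map_intCast] at h1
      exact hx ((ZMod.intCast_zmod_eq_zero_iff_dvd _ _).1 h1.symm)
    refine ⟨a, ha, b.val, Finset.mem_image_of_mem _ (Finset.mem_filter.2 ⟨hb, hbu⟩), ?_⟩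
    rw [hdvd, Int.cast_mul, hcast, hab]
  · simp only [Finset.mem_image, Finset.mem_filter]
    rintro a ha a' ha' _ ⟨b, ⟨hb, -⟩, rfl⟩ _ ⟨b', ⟨hb', -⟩, rfl⟩ hab
    rw [hdvd, Int.cast_mul, Int.cast_mul, hcast, hcast] at hab
    obtain ⟨h1, h2⟩ := h.1.eq_of_mul_eq ha ha' hb hb' hab
    exact ⟨h1, by rw [h2]⟩

/-- If `n = u * v` with `u > v > 1` coprime, the residue of `u ^ 2` is not covered: `u ^ 2` would
divide an element of `[-k₁, k₂]^*`. -/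
lemma IsUnitTiling.false_of_coprime_mul {k₁ k₂ n : ℕ} {B : Finset ℤ} (T : IsUnitTiling k₁ k₂ n B)
    (hn : n = k₁ + k₂ + 1) {u v : ℕ} (huv : n = u * v) (hcop : u.Coprime v) (hv : 1 < v)
    (hlt : v < u) : False := by
  have hnd : ¬ (n : ℤ) ∣ (u : ℤ) ^ 2 := by
    intro h
    have h1 : v ∣ u ^ 2 := (Dvd.intro_left u huv.symm).trans (by exact_mod_cast h)
    have h2 := Nat.Coprime.eq_one_of_dvd (Nat.Coprime.pow_left 2 hcop).symm h1
    omega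
  obtain ⟨a, ha, b, hb, hab⟩ := T.exists_mul _ hnd
  have h1 : (u : ℤ) ^ 2 ∣ a * b := by
    have h2 : (u : ℤ) ^ 2 ∣ (n : ℤ) ^ 2 := by
      rw [huv]; push_cast; rw [mul_pow]; exact dvd_mul_right _ _
    exact (dvd_sub_right (dvd_refl _)).1 (h2.trans hab)
  have hcb : IsCoprime ((u : ℤ) ^ 2) b :=
    ((T.isCoprime b hb).of_isCoprime_of_dvd_right
      (by rw [huv]; push_cast; exact dvd_mul_right _ _)).symm.pow_left
  have h2 := hcb.dvd_of_dvd_mul_right h1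
  rw [mem_starInterval] at ha
  refine ha.1 (Int.eq_zero_of_abs_lt_dvd h2 ?_)
  have h3 : (n : ℤ) < (u : ℤ) ^ 2 := by rw [huv]; push_cast; nlinarith
  rw [abs_lt]; omega

/-! ### Tilings for prime powers -/

/-- The integers `a` prime to `p` with `p ^ j * a ∈ [-k₁, k₂]^*`, that is, the prime-to-`p` parts of
the elements of `[-k₁, k₂]^*` of `p`-adic valuation `j`. -/
noncomputable def valuationLayer (k₁ k₂ p j : ℕ) : Finset ℤ :=
  (starInterval k₁ k₂).filter fun a => ¬ (p : ℤ) ∣ a ∧ (p : ℤ) ^ j * a ∈ starInterval k₁ k₂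

lemma mem_valuationLayer {k₁ k₂ p j : ℕ} (hp : p.Prime) {a : ℤ} :
    a ∈ valuationLayer k₁ k₂ p j ↔ ¬ (p : ℤ) ∣ a ∧ (p : ℤ) ^ j * a ∈ starInterval k₁ k₂ := by
  rw [valuationLayer, Finset.mem_filter, and_iff_right_iff_imp]
  rintro ⟨hpa, ha⟩
  rw [mem_starInterval] at ha ⊢
  have h1 : (1 : ℤ) ≤ (p : ℤ) ^ j := by exact_mod_cast Nat.one_le_pow _ _ hp.pos
  refine ⟨right_ne_zero_of_mul ha.1, ?_, ?_⟩
  · by_contra! h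
    nlinarith
  · by_contra! h
    nlinarith

section PrimePower

variable {k₁ k₂ p e : ℕ} {B : Finset ℤ}

/-- The elements of `[-k₁, k₂]^*` of valuation `j < e` have to produce, in a unique way, the
residues of valuation `j`; after division by `p ^ j` these are the units modulo `p ^ (2 * e - j)`. -/
lemma IsUnitTiling.sum_mul_sum_eq (T : IsUnitTiling k₁ k₂ (p ^ e) B) (hp : p.Prime)
    {j : ℕ} (hj : j < e) [NeZero (p ^ (2 * e - j))] {R : Type*} [CommRing R]
    (ψ : MulChar (ZMod (p ^ (2 * e - j))) R) :
    (∑ a ∈ valuationLayer k₁ k₂ p j, ψ (a : ZMod (p ^ (2 * e - j))))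
      * ∑ b ∈ B, ψ (b : ZMod (p ^ (2 * e - j))) = ∑ x, ψ x := by
  have hpj : (p : ℤ) ^ j ≠ 0 := pow_ne_zero _ (by exact_mod_cast hp.ne_zero)
  have hsplit : ((p ^ e : ℕ) : ℤ) ^ 2 = (p : ℤ) ^ j * (p : ℤ) ^ (2 * e - j) := by
    rw [← pow_add]; push_cast; rw [← pow_mul]; congr 1; omega
  have hpB {b : ℤ} (hb : b ∈ B) : IsCoprime (p : ℤ) b := by
    refine ((T.isCoprime b hb).of_isCoprime_of_dvd_right ?_).symm
    push_cast
    exact dvd_pow_self _ (by omega)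
  rw [Finset.sum_mul_sum, ← Finset.sum_product']
  refine Finset.sum_of_injOn (fun ab : ℤ × ℤ => ((ab.1 * ab.2 : ℤ) : ZMod (p ^ (2 * e - j)))) ?_
    (fun _ _ => Finset.mem_coe.2 (Finset.mem_univ _)) ?_
    (fun ab _ => by rw [Int.cast_mul, map_mul])
  · rintro ⟨a, b⟩ hab ⟨a', b'⟩ hab' heq
    rw [Finset.mem_coe, Finset.mem_product] at hab hab'
    obtain ⟨ha, hb⟩ := hab
    obtain ⟨ha', hb'⟩ := hab'
    have h1 : (p : ℤ) ^ (2 * e - j) ∣ a * b - a' * b' := by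
      have h2 : ((a * b - a' * b' : ℤ) : ZMod (p ^ (2 * e - j))) = 0 := by
        rw [Int.cast_sub, sub_eq_zero]; exact heq
      rw [ZMod.intCast_zmod_eq_zero_iff_dvd] at h2
      exact_mod_cast h2
    obtain ⟨h3, h4⟩ := T.eq_of_dvd _ ((mem_valuationLayer hp).1 ha).2 _
      ((mem_valuationLayer hp).1 ha').2 b hb b' hb' (by
        rw [hsplit, mul_assoc, mul_assoc, ← mul_sub]
        exact mul_dvd_mul_left _ h1)
    exact Prod.ext (mul_left_cancel₀ hpj h3) h4
  · intro x _ hx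
    refine MulChar.map_nonunit _ fun hxu => hx ?_
    obtain ⟨u, rfl⟩ := ZMod.intCast_surjective x
    have hu := not_dvd_of_isUnit_intCast_zmod_prime_pow hp (by omega) hxu
    have hnd : ¬ ((p ^ e : ℕ) : ℤ) ∣ (p : ℤ) ^ j * u := by
      intro h
      have h1 : (p : ℤ) ^ j * p ∣ (p : ℤ) ^ j * u := by
        rw [← pow_succ]
        refine dvd_trans ?_ h
        push_cast
        exact pow_dvd_pow _ hj
      exact hu ((mul_dvd_mul_iff_left hpj).1 h1)
    obtain ⟨a₀, ha₀, b, hb, hab⟩ := T.exists_mul _ hnd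
    rw [hsplit] at hab
    obtain ⟨a, rfl⟩ : (p : ℤ) ^ j ∣ a₀ :=
      (hpB hb).pow_left.dvd_of_dvd_mul_right
        ((dvd_sub_right (dvd_mul_right _ _)).1 ((dvd_mul_right _ _).trans hab))
    rw [mul_assoc, ← mul_sub, mul_dvd_mul_iff_left hpj] at hab
    refine ⟨(a, b), Finset.mem_coe.2 (Finset.mem_product.2
      ⟨(mem_valuationLayer hp).2 ⟨fun hpa => hu ?_, ha₀⟩, hb⟩), ?_⟩
    · have h1 : (p : ℤ) ∣ u - a * b := (dvd_pow_self _ (by omega)).trans hab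
      exact (dvd_sub_left (hpa.mul_right b)).1 h1
    · exact (intCast_zmod_eq_of_dvd (by push_cast; rfl) hab).symm

open Polynomial in
lemma IsUnitTiling.cyclotomic_dvd_or (T : IsUnitTiling k₁ k₂ (p ^ e) B) (hp : p.Prime)
    {δ : ℕ} {f : ℤ → ℕ} (hf : IsPrimePowerLog p δ (2 * e) f) {i j : ℕ} (hj : j < e)
    (hi : 1 ≤ i) (hij : i + δ ≤ 2 * e - j) :
    cyclotomic (p ^ i) ℤ ∣ exponentSum (valuationLayer k₁ k₂ p j) f ∨
      cyclotomic (p ^ i) ℤ ∣ exponentSum B f := by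
  have hpi : 0 < p ^ i := pow_pos hp.pos i
  have : NeZero (p ^ (2 * e - j)) := ⟨(pow_pos hp.pos _).ne'⟩
  have hζ := Complex.isPrimitiveRoot_exp (p ^ i) hpi.ne'
  obtain ⟨ψ, hψ, hψf⟩ := hf (2 * e - j) i _ (by omega) hi hij hζ
  have h := T.sum_mul_sum_eq hp hj ψ
  rw [MulChar.sum_eq_zero_of_ne_one hψ, mul_eq_zero] at h
  rw [cyclotomic_dvd_exponentSum_iff _ _ hpi hζ, cyclotomic_dvd_exponentSum_iff _ _ hpi hζ]
  refine h.imp (fun h => ?_) (fun h => ?_)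
  · rw [← h]
    exact Finset.sum_congr rfl fun a ha => (hψf a ((mem_valuationLayer hp).1 ha).1).symm
  · rw [← h]
    refine Finset.sum_congr rfl fun b hb => (hψf b ?_).symm
    rw [← (Nat.prime_iff_prime_int.1 hp).coprime_iff_not_dvd]
    refine ((T.isCoprime b hb).of_isCoprime_of_dvd_right ?_).symm
    push_cast
    exact dvd_pow_self _ (by omega)

open Polynomial in
/-- The layer of valuation `e - 1` has `p - 1` elements, a number prime to `p`, so that no
cyclotomic polynomial of `p`-power order divides its exponent sum. -/
lemma IsUnitTiling.cyclotomic_dvd_of_add_le (T : IsUnitTiling k₁ k₂ (p ^ e) B) (hp : p.Prime)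
    (he : 1 ≤ e) {δ : ℕ} {f : ℤ → ℕ} (hf : IsPrimePowerLog p δ (2 * e) f) {i : ℕ}
    (hi : 1 ≤ i) (hie : i + δ ≤ e + 1) :
    cyclotomic (p ^ i) ℤ ∣ exponentSum B f := by
  have : NeZero (p ^ (2 * e - (e - 1))) := ⟨(pow_pos hp.pos _).ne'⟩
  refine (T.cyclotomic_dvd_or hp hf (j := e - 1) (by omega) hi (by omega)).resolve_left fun h => ?_
  have hd := prime_pow_card_dvd_card hp {i} (by simpa using ⟨hi, h⟩)
  have hcard := T.sum_mul_sum_eq hp (j := e - 1) (by omega) (1 : MulChar _ ℤ)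
  have hone {S : Finset ℤ} (hS : ∀ a ∈ S, ¬ (p : ℤ) ∣ a) :
      ∑ a ∈ S, (1 : MulChar (ZMod (p ^ (2 * e - (e - 1)))) ℤ)
        (a : ZMod (p ^ (2 * e - (e - 1)))) = S.card := by
    rw [Finset.sum_congr rfl fun a ha =>
      MulChar.one_apply (isUnit_intCast_zmod_prime_pow hp (hS a ha))]
    simp
  rw [hone fun a ha => ((mem_valuationLayer hp).1 ha).1, hone fun b hb => by
      rw [← (Nat.prime_iff_prime_int.1 hp).coprime_iff_not_dvd]
      refine ((T.isCoprime b hb).of_isCoprime_of_dvd_right ?_).symm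
      push_cast
      exact dvd_pow_self _ (by omega),
    MulChar.sum_one_eq_card_units, ZMod.card_units_eq_totient, T.card_eq,
    show 2 * e - (e - 1) = e + 1 by omega, Nat.totient_prime_pow_succ hp, mul_comm] at hcard
  have hcard' : (valuationLayer k₁ k₂ p (e - 1)).card = p - 1 :=
    Nat.eq_of_mul_eq_mul_left (pow_pos hp.pos e) (by exact_mod_cast hcard)
  rw [hcard', Finset.card_singleton, pow_one] at hd
  have := Nat.le_of_dvd (by have := hp.two_le; omega) hd
  have := hp.pos
  omega

lemma IsPrimePowerLog.dvd_one {δ N : ℕ} {f : ℤ → ℕ} (hf : IsPrimePowerLog p δ N f) (hp : p.Prime)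
    {i : ℕ} (hi : 1 ≤ i) (hiN : i + δ ≤ N) : p ^ i ∣ f 1 := by
  have hζ := Complex.isPrimitiveRoot_exp (p ^ i) (pow_pos hp.pos i).ne'
  obtain ⟨ψ, -, hψf⟩ := hf N i _ le_rfl hi hiN hζ
  have h1 := hψf 1 (Nat.prime_iff_prime_int.1 hp).not_dvd_one
  rw [Int.cast_one, map_one] at h1
  exact (hζ.pow_eq_one_iff_dvd _).1 h1.symm

open Polynomial in
/-- For odd `p`, divisibility would give `p` elements of `[-k₁, k₂]^*`, distinct modulo `p ^ e`,
among the `p - 1` solutions of `u ^ (p - 1) = 1` modulo `p ^ (2 * e - 1)`. -/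
lemma not_cyclotomic_dvd_valuationLayer_odd (hp : p.Prime) (hp2 : p ≠ 2)
    (he : 2 ≤ e) (hn : p ^ e = k₁ + k₂ + 1) (hk₂ : 1 ≤ k₂) {f : ℤ → ℕ}
    (hf : IsPrimePowerLog p 1 (2 * e) f)
    (hf' : ∀ (a : ℤ) (t : ℕ), ¬ (p : ℤ) ∣ a → t + 1 ≤ 2 * e → p ^ t ∣ f a →
        (a : ZMod (p ^ (t + 1))) ^ (p - 1) = 1) :
    ¬ cyclotomic (p ^ (2 * e - 1)) ℤ ∣ exponentSum (valuationLayer k₁ k₂ p 0) f := by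
  intro h
  obtain ⟨t, ht⟩ : ∃ t, 2 * e - 1 = t + 1 := ⟨2 * e - 2, by omega⟩
  have : NeZero (p ^ (t + 1)) := ⟨(pow_pos hp.pos _).ne'⟩
  have h1mem : (1 : ℤ) ∈ valuationLayer k₁ k₂ p 0 :=
    (mem_valuationLayer hp).2
      ⟨(Nat.prime_iff_prime_int.1 hp).not_dvd_one, mem_starInterval.2 (by simp; omega)⟩
  rw [ht] at h
  have hex (c : Fin p) : ∃ a ∈ valuationLayer k₁ k₂ p 0, f a % p ^ (t + 1) = p ^ t * c := by
    obtain ⟨a, ha, hfa⟩ := exists_mod_eq_of_cyclotomic_dvd hp h h1mem c.2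
    have h0 : f 1 % p ^ t = 0 := Nat.mod_eq_zero_of_dvd (hf.dvd_one hp (by omega) (by omega))
    exact ⟨a, ha, by rw [hfa, h0, add_zero]⟩
  choose a ha hfa using hex
  have hpa (c : Fin p) : ¬ (p : ℤ) ∣ a c := ((mem_valuationLayer hp).1 (ha c)).1
  have hmem (c : Fin p) : a c ∈ starInterval k₁ k₂ := by
    simpa using ((mem_valuationLayer hp).1 (ha c)).2
  choose u hu using fun c => isUnit_intCast_zmod_prime_pow hp (m := t + 1) (hpa c)
  have hupow (c : Fin p) : u c ^ (p - 1) = 1 := by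
    ext
    rw [Units.val_pow_eq_pow_val, hu, Units.val_one]
    refine hf' _ t (hpa c) (by omega) ?_
    rw [← Nat.dvd_mod_iff (pow_dvd_pow p (Nat.le_succ t)), hfa]
    exact dvd_mul_right _ _
  have hinj : Function.Injective u := by
    intro c c' hcc
    have h1 : ((a c - a c' : ℤ) : ZMod (p ^ (t + 1))) = 0 := by
      rw [Int.cast_sub, ← hu, ← hu, hcc, sub_self]
    rw [ZMod.intCast_zmod_eq_zero_iff_dvd] at h1
    have h2 : a c = a c' := eq_of_dvd_sub_of_mem_starInterval hn (hmem c) (hmem c')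
      (dvd_trans (by exact_mod_cast pow_dvd_pow p (show e ≤ t + 1 by omega)) h1)
    have h3 := hfa c
    rw [h2, hfa c'] at h3
    exact Fin.ext (Nat.eq_of_mul_eq_mul_left (pow_pos hp.pos t) h3).symm
  have := ZMod.isCyclic_units_of_prime_pow p hp hp2 (t + 1)
  have hle := IsCyclic.card_pow_eq_one_le (α := (ZMod (p ^ (t + 1)))ˣ)
    (show 0 < p - 1 by have := hp.two_le; omega)
  have hge : p ≤ (Finset.univ.filter
      (fun x : (ZMod (p ^ (t + 1)))ˣ => x ^ (p - 1) = 1)).card := by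
    have h1 : (Finset.univ.image u).card = p := by
      rw [Finset.card_image_of_injective _ hinj, Finset.card_univ, Fintype.card_fin]
    refine h1.symm.le.trans (Finset.card_le_card fun x hx => ?_)
    obtain ⟨c, -, rfl⟩ := Finset.mem_image.1 hx
    exact Finset.mem_filter.2 ⟨Finset.mem_univ _, hupow c⟩
  have := hp.two_le
  omega

open Polynomial in
/-- Divisibility would give an element of the layer which is `± 1` modulo a power of `2` exceeding
its size, hence equal to `± 1`, and yet has a nonzero logarithm. -/
lemma not_cyclotomic_dvd_valuationLayer_two (he : 3 ≤ e) (hn : 2 ^ e = k₁ + k₂ + 1)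
    (hk₂ : 2 ≤ k₂) {f : ℤ → ℕ} (hf : IsPrimePowerLog 2 2 (2 * e) f)
    (hneg : 2 ^ (2 * e - 2) ∣ f (-1))
    (hf' : ∀ (a : ℤ) (t : ℕ), ¬ (2 : ℤ) ∣ a → t + 2 ≤ 2 * e → 2 ^ t ∣ f a →
        2 ^ (t + 2) ∣ a - 1 ∨ 2 ^ (t + 2) ∣ a + 1) {j : ℕ} (hj : j ≤ 1) :
    ¬ cyclotomic (2 ^ (2 * e - 2 - j)) ℤ ∣ exponentSum (valuationLayer k₁ k₂ 2 j) f := by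
  intro h
  obtain ⟨t, ht⟩ : ∃ t, 2 * e - 2 - j = t + 1 := ⟨2 * e - 3 - j, by omega⟩
  rw [ht] at h
  have h1mem : (1 : ℤ) ∈ valuationLayer k₁ k₂ 2 j := by
    refine (mem_valuationLayer Nat.prime_two).2 ⟨by norm_num, mem_starInterval.2 ?_⟩
    interval_cases j <;> simp <;> omega
  obtain ⟨a, ha, hfa⟩ := exists_mod_eq_of_cyclotomic_dvd Nat.prime_two h h1mem one_lt_two
  have h0 : f 1 % 2 ^ t = 0 :=
    Nat.mod_eq_zero_of_dvd (hf.dvd_one Nat.prime_two (by omega) (by omega))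
  rw [h0, add_zero, mul_one] at hfa
  have hne : f a % 2 ^ (t + 1) ≠ 0 := by rw [hfa]; exact (pow_pos two_pos t).ne'
  have hdvd : 2 ^ t ∣ f a := by
    rw [← Nat.dvd_mod_iff (pow_dvd_pow 2 (Nat.le_succ t)), hfa]
  have hmem := (Finset.mem_filter.1 ha).1
  rw [mem_starInterval] at hmem
  have hlt : (2 : ℤ) ^ e < 2 ^ (t + 2) := pow_lt_pow_right₀ one_lt_two (by omega)
  have hn' : (2 : ℤ) ^ e = k₁ + k₂ + 1 := by exact_mod_cast hn
  rcases hf' a t ((mem_valuationLayer Nat.prime_two).1 ha).1 (by omega) hdvd with h1 | h1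
  · have h2 := Int.eq_zero_of_abs_lt_dvd h1 (by rw [abs_lt]; omega)
    rw [show a = 1 by omega] at hne
    exact hne (Nat.mod_eq_zero_of_dvd (hf.dvd_one Nat.prime_two (by omega) (by omega)))
  · have h2 := Int.eq_zero_of_abs_lt_dvd h1 (by rw [abs_lt]; omega)
    rw [show a = -1 by omega] at hne
    exact hne (Nat.mod_eq_zero_of_dvd ((pow_dvd_pow 2 (by omega)).trans hneg))

open Polynomial in
lemma IsUnitTiling.false_of_prime_pow (T : IsUnitTiling k₁ k₂ (p ^ e) B) (hp : p.Prime)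
    (he : 2 ≤ e) (hn : p ^ e = k₁ + k₂ + 1) (hk₁ : 1 ≤ k₁) (hk₂ : 3 ≤ k₂) : False := by
  suffices h : ∃ (f : ℤ → ℕ) (I : Finset ℕ), I.card = e + 1 ∧
      ∀ i ∈ I, 1 ≤ i ∧ cyclotomic (p ^ i) ℤ ∣ exponentSum B f by
    obtain ⟨f, I, hI, h⟩ := h
    have h1 := prime_pow_card_dvd_card hp I h
    rw [hI, T.card_eq] at h1
    have := (Nat.pow_dvd_pow_iff_le_right hp.one_lt).1 h1
    omega
  rcases eq_or_ne p 2 with rfl | hp2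
  · have he3 : 3 ≤ e := by
      by_contra! h
      have : e = 2 := by omega
      subst this
      omega
    obtain ⟨f, hf, hneg, hf'⟩ := exists_isPrimePowerLog_two (N := 2 * e) (by omega)
    have htop (j : ℕ) (hj : j ≤ 1) : cyclotomic (2 ^ (2 * e - 2 - j)) ℤ ∣ exponentSum B f :=
      (T.cyclotomic_dvd_or hp hf (j := j) (by omega) (by omega) (by omega)).resolve_left
        (not_cyclotomic_dvd_valuationLayer_two he3 hn (by omega) hf hneg hf' hj)
    refine ⟨f, insert (2 * e - 2) (insert (2 * e - 3) (Finset.Icc 1 (e - 1))), ?_, ?_⟩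
    · rw [Finset.card_insert_of_notMem (by simp; omega),
        Finset.card_insert_of_notMem (by simp; omega), Nat.card_Icc]
      omega
    · intro i hi
      simp only [Finset.mem_insert, Finset.mem_Icc] at hi
      refine ⟨by omega, ?_⟩
      rcases hi with rfl | rfl | hi
      · exact htop 0 (by omega)
      · exact htop 1 le_rfl
      · exact T.cyclotomic_dvd_of_add_le hp (by omega) hf hi.1 (by omega)
  · obtain ⟨f, hf, hf'⟩ := exists_isPrimePowerLog_odd hp hp2 (N := 2 * e) (by omega)
    refine ⟨f, insert (2 * e - 1) (Finset.Icc 1 e), ?_, ?_⟩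
    · rw [Finset.card_insert_of_notMem (by simp; omega), Nat.card_Icc]
      omega
    · intro i hi
      simp only [Finset.mem_insert, Finset.mem_Icc] at hi
      refine ⟨by omega, ?_⟩
      rcases hi with rfl | hi
      · exact (T.cyclotomic_dvd_or hp hf (j := 0) (by omega) (by omega) (by omega)).resolve_left
          (not_cyclotomic_dvd_valuationLayer_odd hp hp2 he hn (by omega) hf hf')
      · exact T.cyclotomic_dvd_of_add_le hp (by omega) hf hi.1 (by omega)

end PrimePower

/-! ### Nonexistence of perfect splitter sets -/

theorem theorem3p3 (k₁ k₂ n : ℕ) (hk₁ : 1 ≤ k₁) (hk : k₁ ≤ k₂) (hk₂ : 3 ≤ k₂)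
    (hn : n = k₁ + k₂ + 1) (hnp : ¬ n.Prime) :
    ¬ ∃ B : Finset (ZMod (n ^ 2)), IsPerfectSplitterSet k₁ k₂ (n ^ 2) B := by
  rintro ⟨B, hB⟩
  obtain ⟨B', T⟩ := hB.exists_isUnitTiling hk₁ hk hn
  have hp : n.minFac.Prime := Nat.minFac_prime (by omega)
  obtain ⟨e, m, hm, hem⟩ := Nat.exists_eq_pow_mul_and_not_dvd (n := n) (by omega) n.minFac hp.ne_one
  set p := n.minFac with hpdef
  have he0 : e ≠ 0 := by
    rintro rfl
    rw [pow_zero, one_mul] at hem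
    exact hm (hem ▸ n.minFac_dvd)
  have hm0 : m ≠ 0 := by rintro rfl; simp at hm
  rcases eq_or_ne m 1 with rfl | hm1
  · rw [mul_one] at hem
    have he1 : e ≠ 1 := by
      rintro rfl
      rw [pow_one] at hem
      exact hnp (hem ▸ hp)
    clear_value p
    subst hem
    exact T.false_of_prime_pow hp (by omega) hn hk₁ hk₂
  · have hcop : (p ^ e).Coprime m := Nat.Coprime.pow_left e ((hp.coprime_iff_not_dvd).2 hm)
    have hpe : 1 < p ^ e := Nat.one_lt_pow he0 hp.one_lt
    rcases lt_trichotomy m (p ^ e) with h | h | h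
    · exact T.false_of_coprime_mul hn hem hcop (by omega) h
    · rw [h, Nat.coprime_self] at hcop
      omega
    · exact T.false_of_coprime_mul hn (by rw [mul_comm]; exact hem) hcop.symm hpe h
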